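/- All functors are endofunctors of $\mathsf{Set}$. For a functor $A$ let $A_0 = 1$, $A_{n+1} = A(A_n)$ with connecting maps $A_{1,0} \colon A_1 \to 1$ and $A_{n+2,n+1} = A(A_{n+1,n})$, and let $A_\omega = \lim_{n<\omega} A_n$ with projections $A_{\omega,n} \colon A_\omega \to A_n$; let $A_{\omega+1,\omega} \colon A(A_\omega) \to A_\omega$ be the map with $A_{\omega,n+1}\circ A_{\omega+1,\omega} = A(A_{\omega,n})$ for all $n$. $A$ is *$\omega$-continuous* if it preserves limits of $\omega^{\mathrm{op}}$-chains; then $A_{\omega+1,\omega}$ is invertible and $\zeta_A = A_{\omega+1,\omega}^{-1} \colon A_\omega \to A(A_\omega)$ is a final $A$-coalgebra. A functor $B$ is *polynomial* if it is isomorphic to $X \mapsto \coprod_{a\in I} X^{E_a}$ for some family of sets $(E_a)_{a\in I}$; polynomial functors are $\omega$-continuous. For functors $A, B, F$, a map $\alpha \colon F A_\omega \to B_\omega$ is *causal* if for every set $X$, all $f,g\colon X\to A_\omega$ and all $i<\omega$, $A_{\omega,i}\circ f = A_{\omega,i}\circ g$ implies $B_{\omega,i}\circ\alpha\circ Ff =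 B_{\omega,i}\circ\alpha\circ Fg$. If $\zeta_A\colon Z_A\to AZ_A$ and $\zeta_B\colon Z_B\to BZ_B$ are final coalgebras and $\lambda\colon GA\Rightarrow BG$ is a natural transformation, the *map induced by $\lambda$* is the unique $\beta\colon GZ_A\to Z_B$ with $\zeta_B\circ\beta = B\beta\circ\lambda_{Z_A}\circ G\zeta_A$. An algebra $\alpha\colon FZ\to Z$ on a final $B$-coalgebra $(Z,\zeta)$ is *definable by a distributive law* if there are a functor $G$, a natural transformation $\lambda\colon GB\Rightarrow BG$ with induced map $\beta\colon GZ\to Z$, and a natural transformation $\kappa\colon F\Rightarrow G$ with $\alpha = \beta\circ\kappa_Z$. **Theorem.** 1. Let $A$ be $\omega$-continuous, $B$ polynomial and $F$ any functor. A map $\alpha\colon FA_\omega\to B_\omega$ is causal if and only if there are a functor $G$, a natural transformation $\lambda\colon GA\Rightarrow BG$ and a natural transformation $\kappa\colon F\Rightarrow G$ such that $\alpha = \beta_\omega\circ\kappa_{A_\omega}$, where $\beta_\omega\colon GA_\omega\to B_\omega$ is the map induced by $\lambda$. 2. In particular, for $B$ polynomial and any functor $F$, an algebra $\alpha\colon FB_\omega\to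 B_\omega$ is causal if and only if it is definable by a distributive law. 3. In particular, on streams: let $K$ and $V$ be sets (for instance $K=\mathbb{R}$), and consider $BX = K\times X$ with the final coalgebra $K^{\mathbb{N}}$, $\sigma\mapsto(\sigma(0),(\sigma(n+1))_n)$. A function $\varphi\colon (K^{\mathbb{N}})^V\to K^{\mathbb{N}}$ is a causal stream function (for all $i$ and all $\sigma,\tau\in(K^{\mathbb{N}})^V$, if $\sigma_v(k)=\tau_v(k)$ for all $v\in V$ and $k<i$, then $\varphi(\sigma)(k)=\varphi(\tau)(k)$ for all $k<i$) if and only if $\varphi$, as an algebra for the functor $F = (-)^V$, is definable by a distributive law. -/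

import Mathlib

open CategoryTheory CategoryTheory.Limits

universe u

namespace CausalDL

noncomputable section

/-! ### The final sequence up to `ω` -/

/-- The finite stages `A_0 = 1`, `A_{n+1} = A (A_n)` of the final sequence of `A`. -/
def stage (A : Type u ⥤ Type u) : ℕ → Type u
  | 0 => PUnit.{u + 1}
  | n + 1 => A.obj (stage A n)

/-- The connecting maps `A_{n+1,n} : A_{n+1} ⟶ A_n`, with `A_{1,0}` the map to the one-point set
and `A_{n+2,n+1} = A (A_{n+1,n})`. -/
def stageMap (A : Type u ⥤ Type u) : ∀ n : ℕ, stage A (n + 1) ⟶ stage A n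
  | 0 => ↾(fun _ => PUnit.unit)
  | n + 1 => A.map (stageMap A n)

/-- The final sequence of `A` restricted to finite ordinals. -/
def finalChain (A : Type u ⥤ Type u) : ℕᵒᵖ ⥤ Type u :=
  Functor.ofOpSequence (stageMap A)

/-- `A_ω`, the limit of the finite stages of the final sequence. -/
def omega (A : Type u ⥤ Type u) : Type u := limit (finalChain A)

/-- The projection `A_{ω,n} : A_ω ⟶ A_n`. -/
def omegaProj (A : Type u ⥤ Type u) (n : ℕ) : omega A ⟶ stage A n :=
  limit.π (finalChain A) (Opposite.op n)

/-- The map from `X` to `A_ω` determined by a compatible family of maps to the stages. -/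
def omegaLift (A : Type u ⥤ Type u) {X : Type u} (p : ∀ n, X ⟶ stage A n)
    (hp : ∀ n, p (n + 1) ≫ stageMap A n = p n) : X ⟶ omega A :=
  limit.lift (finalChain A)
    { pt := X
      π := NatTrans.ofOpSequence (F := (Functor.const _).obj X) (G := finalChain A) p
        (fun n => by
          have h := Functor.ofOpSequence_map_homOfLE_succ (stageMap A) n
          simp only [Functor.const_obj_obj, Functor.const_obj_map]
          exact (hp n).symm.trans (congrArg (fun t => p (n + 1) ≫ t) h.symm)) }

theorem omegaLift_proj (A : Type u ⥤ Type u) {X : Type u} (p : ∀ n, X ⟶ stage A n)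
    (hp : ∀ n, p (n + 1) ≫ stageMap A n = p n) (n : ℕ) :
    omegaLift A p hp ≫ omegaProj A n = p n :=
  limit.lift_π _ _

theorem omegaProj_succ (A : Type u ⥤ Type u) (n : ℕ) :
    omegaProj A (n + 1) ≫ stageMap A n = omegaProj A n := by
  have h := limit.w (finalChain A) (homOfLE (Nat.le_add_right n 1)).op
  have h' := Functor.ofOpSequence_map_homOfLE_succ (stageMap A) n
  exact (congrArg (fun t => omegaProj A (n + 1) ≫ t) h').symm.trans h

theorem omega_hom_ext (A : Type u ⥤ Type u) {X : Type u} {f g : X ⟶ omega A}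
    (h : ∀ n, f ≫ omegaProj A n = g ≫ omegaProj A n) : f = g :=
  limit.hom_ext (fun j => h j.unop)

theorem stage_zero_hom_ext (A : Type u ⥤ Type u) {X : Type u} (f g : X ⟶ stage A 0) : f = g := by
  ext x
  exact Subsingleton.elim (α := PUnit) _ _

/-- The components of the map `A_{ω+1,ω}` into the stages. -/
def omegaSuccProj (A : Type u ⥤ Type u) : ∀ n : ℕ, A.obj (omega A) ⟶ stage A n
  | 0 => ↾(fun _ => PUnit.unit)
  | n + 1 => A.map (omegaProj A n)

theorem omegaSuccProj_succ (A : Type u ⥤ Type u) (n : ℕ) :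
    omegaSuccProj A (n + 1) ≫ stageMap A n = omegaSuccProj A n := by
  cases n with
  | zero => exact stage_zero_hom_ext A _ _
  | succ n => exact (A.map_comp _ _).symm.trans (congrArg A.map (omegaProj_succ A n))

/-- The connecting map `A_{ω+1,ω} : A (A_ω) ⟶ A_ω` of the final sequence. -/
def omegaConn (A : Type u ⥤ Type u) : A.obj (omega A) ⟶ omega A :=
  omegaLift A (omegaSuccProj A) (omegaSuccProj_succ A)

theorem omegaConn_proj_succ (A : Type u ⥤ Type u) (n : ℕ) :
    omegaConn A ≫ omegaProj A (n + 1) = A.map (omegaProj A n) :=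
  omegaLift_proj A _ _ (n + 1)

/-! ### `ω`-continuous and polynomial functors -/

/-- `A` preserves limits of `ω^op`-chains. -/
def OmegaContinuous (A : Type u ⥤ Type u) : Prop :=
  PreservesLimitsOfShape ℕᵒᵖ A

/-- The functor `X ↦ ∐_{a} X^{P_a}` of a family of sets. -/
def polyFunctor (P : PFunctor.{u, u}) : Type u ⥤ Type u where
  obj X := Σ a : P.A, (P.B a → X)
  map f := ↾(fun x => ⟨x.1, fun b => f (x.2 b)⟩)

/-- `B` is isomorphic to a functor of the form `X ↦ ∐_{a} X^{P_a}`. -/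
def IsPolynomial (B : Type u ⥤ Type u) : Prop :=
  ∃ P : PFunctor.{u, u}, Nonempty (B ≅ polyFunctor P)

theorem polyFunctor_omegaContinuous (P : PFunctor.{u, u}) : OmegaContinuous (polyFunctor P) := by
  refine ⟨fun {K} => ⟨fun {c} hc => (Types.isLimit_iff _).2 fun s hs => ?_⟩⟩
  have hsec := (Types.isLimit_iff c).1 ⟨hc⟩
  have hfst : ∀ n : ℕ, (s (Opposite.op n)).1 = (s (Opposite.op 0)).1 := fun n =>
    congrArg Sigma.fst (hs (homOfLE (Nat.zero_le n)).op)
  have hg : ∀ j : ℕᵒᵖ, ∃ g : P.B (s (Opposite.op 0)).1 → K.obj j,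
      s j = ⟨(s (Opposite.op 0)).1, g⟩ := by
    intro j
    have h := hfst j.unop
    change (s j).1 = _ at h
    revert h
    generalize s j = t
    generalize (s (Opposite.op 0)).1 = a
    rintro rfl
    exact ⟨t.2, rfl⟩
  choose g hg using hg
  have hcomp : ∀ b, (fun j => g j b) ∈ K.sections := by
    intro b j j' φ
    have h := hs φ
    rw [hg j, hg j'] at h
    exact congrFun (eq_of_heq (Sigma.mk.inj h).2) b
  choose x hx hx' using fun b => hsec _ (hcomp b)
  refine ⟨⟨_, x⟩, fun j => ?_, ?_⟩
  · rw [hg j]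
    exact Sigma.ext rfl (heq_of_eq (funext fun b => hx b j))
  · rintro ⟨a, y⟩ hy
    obtain rfl : a = (s (Opposite.op 0)).1 := congrArg Sigma.fst (hy (Opposite.op 0))
    refine Sigma.ext rfl (heq_of_eq (funext fun b => hx' b (y b) fun j => ?_))
    have h := hy j
    rw [hg j] at h
    exact congrFun (eq_of_heq (Sigma.mk.inj h).2) b

theorem IsPolynomial.omegaContinuous {B : Type u ⥤ Type u} (hB : IsPolynomial B) :
    OmegaContinuous B := by
  obtain ⟨P, ⟨e⟩⟩ := hB
  have : PreservesLimitsOfShape ℕᵒᵖ (polyFunctor P) := polyFunctor_omegaContinuous P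
  exact preservesLimitsOfShape_of_natIso e.symm

/-! ### The final coalgebra on `A_ω` -/

theorem map_omega_hom_ext {A : Type u ⥤ Type u} (hA : OmegaContinuous A) {X : Type u}
    {f g : X ⟶ A.obj (omega A)}
    (h : ∀ n, f ≫ A.map (omegaProj A n) = g ≫ A.map (omegaProj A n)) : f = g :=
  haveI : PreservesLimitsOfShape ℕᵒᵖ A := hA
  (isLimitOfPreserves A (limit.isLimit (finalChain A))).hom_ext fun j => h j.unop

theorem exists_omega_str {A : Type u ⥤ Type u} (hA : OmegaContinuous A) :
    ∃ r : omega A ⟶ A.obj (omega A), ∀ n, r ≫ A.map (omegaProj A n) = omegaProj A (n + 1) := by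
  have : PreservesLimitsOfShape ℕᵒᵖ A := hA
  have hl := isLimitOfPreserves A (limit.isLimit (finalChain A))
  let c : Cone (finalChain A ⋙ A) :=
    { pt := omega A
      π := NatTrans.ofOpSequence (F := (Functor.const _).obj (omega A)) (G := finalChain A ⋙ A)
        (fun n => omegaProj A (n + 1))
        (fun n => by
          have h := Functor.ofOpSequence_map_homOfLE_succ (stageMap A) n
          simp only [Functor.const_obj_obj, Functor.const_obj_map]
          exact (omegaProj_succ A (n + 1)).symm.trans
            (congrArg (fun t => omegaProj A (n + 2) ≫ A.map t) h.symm)) }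
  exact ⟨hl.lift c, fun n => hl.fac c (Opposite.op n)⟩

theorem isIso_omegaConn {A : Type u ⥤ Type u} (hA : OmegaContinuous A) :
    IsIso (omegaConn A) := by
  obtain ⟨r, hr⟩ := exists_omega_str hA
  refine ⟨r, map_omega_hom_ext hA fun n => ?_, omega_hom_ext A fun n => ?_⟩
  · rw [Category.assoc, hr, Category.id_comp]
    exact omegaConn_proj_succ A n
  · cases n with
    | zero => exact stage_zero_hom_ext A _ _
    | succ n =>
      rw [Category.assoc, omegaConn_proj_succ, Category.id_comp]
      exact hr n

/-- The map `A_{ω+1,ω}⁻¹ : A_ω ⟶ A (A_ω)` of an `ω`-continuous functor. -/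
def omegaStr {A : Type u ⥤ Type u} (hA : OmegaContinuous A) : omega A ⟶ A.obj (omega A) :=
  haveI := isIso_omegaConn hA
  inv (omegaConn A)

theorem omegaStr_conn {A : Type u ⥤ Type u} (hA : OmegaContinuous A) :
    omegaStr hA ≫ omegaConn A = 𝟙 (omega A) :=
  haveI := isIso_omegaConn hA
  IsIso.inv_hom_id (omegaConn A)

theorem omegaStr_proj {A : Type u ⥤ Type u} (hA : OmegaContinuous A) (n : ℕ) :
    omegaStr hA ≫ A.map (omegaProj A n) = omegaProj A (n + 1) := by
  have h := congrArg (fun t => t ≫ omegaProj A (n + 1)) (omegaStr_conn hA)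
  refine Eq.trans ?_ (h.trans (Category.id_comp _))
  exact (congrArg (fun t => omegaStr hA ≫ t) (omegaConn_proj_succ A n).symm).trans
    (Category.assoc _ _ _).symm

/-- The coalgebra `A_{ω+1,ω}⁻¹ : A_ω ⟶ A (A_ω)` of an `ω`-continuous functor. -/
def omegaCoalgebra {A : Type u ⥤ Type u} (hA : OmegaContinuous A) :
    Endofunctor.Coalgebra A where
  V := omega A
  str := omegaStr hA

/-- The maps from the carrier of a coalgebra to the stages of the final sequence. -/
def approx {A : Type u ⥤ Type u} (X : Endofunctor.Coalgebra A) : ∀ n : ℕ, X.V ⟶ stage A n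
  | 0 => ↾(fun _ => PUnit.unit)
  | n + 1 => X.str ≫ A.map (approx X n)

theorem approx_succ {A : Type u ⥤ Type u} (X : Endofunctor.Coalgebra A) (n : ℕ) :
    approx X (n + 1) ≫ stageMap A n = approx X n := by
  induction n with
  | zero => exact stage_zero_hom_ext A _ _
  | succ n ih =>
    change (X.str ≫ A.map (approx X (n + 1))) ≫ A.map (stageMap A n) = X.str ≫ A.map (approx X n)
    rw [Category.assoc, ← A.map_comp, ih]

/-- The map from the carrier of a coalgebra to `A_ω`. -/
def omegaUnfold {A : Type u ⥤ Type u} (X : Endofunctor.Coalgebra A) : X.V ⟶ omega A :=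
  omegaLift A (approx X) (approx_succ X)

theorem omegaUnfold_comm {A : Type u ⥤ Type u} (hA : OmegaContinuous A)
    (X : Endofunctor.Coalgebra A) :
    X.str ≫ A.map (omegaUnfold X) = omegaUnfold X ≫ omegaStr hA :=
  map_omega_hom_ext hA fun n => by
    rw [Category.assoc, Category.assoc, omegaStr_proj, ← A.map_comp, omegaUnfold, omegaLift_proj]
    exact (omegaLift_proj A _ (approx_succ X) (n + 1)).symm

theorem omegaUnfold_unique {A : Type u ⥤ Type u} (hA : OmegaContinuous A)
    (X : Endofunctor.Coalgebra A) (m : X.V ⟶ omega A)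
    (hm : X.str ≫ A.map m = m ≫ omegaStr hA) : m = omegaUnfold X :=
  omega_hom_ext A fun n => by
    rw [omegaUnfold, omegaLift_proj]
    induction n with
    | zero => exact stage_zero_hom_ext A _ _
    | succ n ih =>
      have h := congrArg (fun t => t ≫ A.map (omegaProj A n)) hm
      simp only [Category.assoc, omegaStr_proj, ← A.map_comp, ih] at h
      exact h.symm

/-- For `ω`-continuous `A`, the coalgebra on `A_ω` is final. -/
def omegaCoalgebraIsTerminal {A : Type u ⥤ Type u} (hA : OmegaContinuous A) :
    IsTerminal (omegaCoalgebra hA) :=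
  IsTerminal.ofUniqueHom
    (fun X => { f := omegaUnfold X, h := omegaUnfold_comm hA X })
    (fun X m => Endofunctor.Coalgebra.ext (omegaUnfold_unique hA X m.f m.h))

/-! ### Causal operations and maps induced by distributive laws -/

/-- `α : F A_ω ⟶ B_ω` is a causal operation from `A` to `B`. -/
def IsCausal (A B F : Type u ⥤ Type u) (α : F.obj (omega A) ⟶ omega B) : Prop :=
  ∀ (X : Type u) (f g : X ⟶ omega A) (i : ℕ),
    f ≫ omegaProj A i = g ≫ omegaProj A i →
      F.map f ≫ α ≫ omegaProj B i = F.map g ≫ α ≫ omegaProj B i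

/-- The map `β : G Z_A ⟶ Z_B` induced by a natural transformation `lam : G A ⟹ B G`, where
`(Z_A, ζ_A)` is an `A`-coalgebra and `(Z_B, ζ_B)` is a final `B`-coalgebra: the unique map with
`ζ_B ∘ β = B β ∘ lam_{Z_A} ∘ G ζ_A`. Note that `A ⋙ G` is the functor `X ↦ G (A X)`. -/
def inducedMap {A B G : Type u ⥤ Type u} (ZA : Endofunctor.Coalgebra A)
    {ZB : Endofunctor.Coalgebra B} (hZB : IsTerminal ZB) (lam : A ⋙ G ⟶ G ⋙ B) :
    G.obj ZA.V ⟶ ZB.V :=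
  (hZB.from (Endofunctor.Coalgebra.mk (G.obj ZA.V) (G.map ZA.str ≫ lam.app ZA.V))).f

theorem eq_inducedMap_iff {A B G : Type u ⥤ Type u} (ZA : Endofunctor.Coalgebra A)
    {ZB : Endofunctor.Coalgebra B} (hZB : IsTerminal ZB) (lam : A ⋙ G ⟶ G ⋙ B)
    (β : G.obj ZA.V ⟶ ZB.V) :
    β = inducedMap ZA hZB lam ↔ β ≫ ZB.str = G.map ZA.str ≫ lam.app ZA.V ≫ B.map β := by
  constructor
  · rintro rfl
    have h := (hZB.from
      (Endofunctor.Coalgebra.mk (G.obj ZA.V) (G.map ZA.str ≫ lam.app ZA.V))).h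
    exact h.symm.trans (Category.assoc _ _ _)
  · intro h
    let m : Endofunctor.Coalgebra.mk (G.obj ZA.V) (G.map ZA.str ≫ lam.app ZA.V) ⟶ ZB :=
      { f := β, h := (Category.assoc _ _ _).trans h.symm }
    exact congrArg Endofunctor.Coalgebra.Hom.f (hZB.hom_ext m (hZB.from _))

/-- An algebra `α : F Z ⟶ Z` on a final `B`-coalgebra is definable by a distributive law: there
are a distributive law `lam : G B ⟹ B G` and a natural transformation `κ : F ⟹ G` such that `α`
is `κ_Z` followed by the algebra induced by `lam`. -/
def DefinableByDistributiveLaw {B F : Type u ⥤ Type u} {Z : Endofunctor.Coalgebra B}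
    (hZ : IsTerminal Z) (α : F.obj Z.V ⟶ Z.V) : Prop :=
  ∃ (G : Type u ⥤ Type u) (lam : B ⋙ G ⟶ G ⋙ B) (κ : F ⟶ G),
    κ.app Z.V ≫ inducedMap Z hZ lam = α

/-! ### Streams -/

/-- The functor `X ↦ K × X`. -/
def streamFunctor (K : Type u) : Type u ⥤ Type u where
  obj X := K × X
  map f := ↾(fun p => (p.1, f p.2))

/-- The coalgebra of streams over `K`, with structure map `σ ↦ (head σ, tail σ)`. -/
def streamCoalgebra (K : Type u) : Endofunctor.Coalgebra (streamFunctor K) where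
  V := ℕ → K
  str := ↾(fun σ => (σ 0, fun n => σ (n + 1)))

/-- The stream of outputs of a state of a stream system. -/
def behaviour {K X : Type u} (s : X → K × X) : ℕ → X → K
  | 0, x => (s x).1
  | n + 1, x => behaviour s n (s x).2

/-- The coalgebra of streams is final. -/
def streamCoalgebraIsTerminal (K : Type u) : IsTerminal (streamCoalgebra K) :=
  IsTerminal.ofUniqueHom
    (fun X =>
      { f := ↾(fun x n => behaviour (K := K) (X := X.V) X.str n x)
        h := by
          ext x
          rfl })
    (fun X m => by
      refine Endofunctor.Coalgebra.ext ?_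
      have key : ∀ (n : ℕ) (x : X.V), (m.f x : ℕ → K) n = behaviour (K := K) (X := X.V) X.str n x := by
        intro n
        induction n with
        | zero =>
          intro x
          exact (congrArg Prod.fst (ConcreteCategory.congr_hom m.h x)).symm
        | succ n ih =>
          intro x
          have h : (m.f (X.str x : K × X.V).2 : ℕ → K) = fun k => (m.f x : ℕ → K) (k + 1) :=
            (congrArg Prod.snd (ConcreteCategory.congr_hom m.h x) :)
          exact (congrFun h n).symm.trans (ih _)
      ext x
      exact funext fun n => key n x)

/-- The functor `X ↦ X^V`. -/
def powerFunctor (V : Type u) : Type u ⥤ Type u where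
  obj X := V → X
  map f := ↾(fun h v => f (h v))

/-- A stream function with `V` arguments is causal: the first `i` values of the result only depend
on the first `i` values of the arguments. -/
def IsCausalStreamFunction {K V : Type u} (φ : (V → ℕ → K) → ℕ → K) : Prop :=
  ∀ (i : ℕ) (σ τ : V → ℕ → K), (∀ v, ∀ k < i, σ v k = τ v k) → ∀ k < i, φ σ k = φ τ k

/-- A stream function with `V` arguments, as an algebra for `X ↦ X^V` on the coalgebra of
streams. -/
def streamAlgebra {K V : Type u} (φ : (V → ℕ → K) → ℕ → K) :
    (powerFunctor V).obj (streamCoalgebra K).V ⟶ (streamCoalgebra K).V :=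
  ↾φ

end

end CausalDL

/-!
If `α` is `κ` followed by the map induced by a distributive law, then `α ≫ B_{ω,n}` factors through
`F A_{ω,n}` (`exists_omegaInduced_proj`), so `α` is causal.

Conversely, let `codensity A B` be the functor of compatible families of functions
`(X ⟶ A_n) → B_n`. It is a limit over a connected diagram, which a polynomial functor `B` preserves
(`IsPolynomial.codensity_existsUnique`). Hence there is a distributive law
`codensity A B (A X) ⟶ B (codensity A B X)` shifting a family by one stage
(`IsPolynomial.exists_codensityLaw`), and the map it induces evaluates a family at the projections
`A_{ω,n}` (`omegaInduced_codensity_proj`). By the Yoneda argument, a natural transformation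
`F ⟹ codensity A B` is a compatible family of maps `F A_n ⟶ B_n`. It remains to present a causal
`α` as the limit of such a family (`IsCausal.exists_stageMaps`).

For surjective projections `A_{ω,n}`, the `n`-th map is `α` precomposed with `F` of a section. In
general one extends a choice of preimages from the image of `A_{ω,n}` to all of `A_n`, compatibly
with the connecting maps (`exists_omegaSection`). The extension needs a point of `A_ω`, which exists
as soon as `A_1` has a point `x`: unfold the coalgebra on one state with transition `x`. At `n = 0`
no section is needed because `B_0` is a point.

The statement on streams follows by transport along the isomorphism between the two final
coalgebras, under which the kernel of the `n`-th projection is agreement of the first `n` values.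
-/

namespace CausalDL

/-! ### Maps induced by distributive laws -/

theorem inducedMap_str {A B G : Type u ⥤ Type u} (ZA : Endofunctor.Coalgebra A)
    {ZB : Endofunctor.Coalgebra B} (hZB : IsTerminal ZB) (lam : A ⋙ G ⟶ G ⋙ B) :
    inducedMap ZA hZB lam ≫ ZB.str =
      G.map ZA.str ≫ lam.app ZA.V ≫ B.map (inducedMap ZA hZB lam) :=
  (eq_inducedMap_iff ZA hZB lam _).1 rfl

/-- Induced maps are compatible with coalgebra morphisms on both sides. -/
theorem map_inducedMap_comp {A B G : Type u ⥤ Type u} {ZA ZA' : Endofunctor.Coalgebra A}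
    {ZB ZB' : Endofunctor.Coalgebra B} (hZB : IsTerminal ZB) (hZB' : IsTerminal ZB')
    (lam : A ⋙ G ⟶ G ⋙ B) (a : ZA' ⟶ ZA) (b : ZB ⟶ ZB') :
    G.map a.f ≫ inducedMap ZA hZB lam ≫ b.f = inducedMap ZA' hZB' lam := by
  have hnat : G.map (A.map a.f) ≫ lam.app ZA.V = lam.app ZA'.V ≫ B.map (G.map a.f) :=
    lam.naturality a.f
  rw [eq_inducedMap_iff, Category.assoc, Category.assoc, ← b.h,
    reassoc_of% inducedMap_str ZA hZB lam, ← G.map_comp_assoc, ← a.h, G.map_comp_assoc,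
    reassoc_of% hnat, B.map_comp, B.map_comp]

/-- Definability by a distributive law does not depend on the choice of the final coalgebra. -/
theorem DefinableByDistributiveLaw.of_iso {B F : Type u ⥤ Type u}
    {Z Z' : Endofunctor.Coalgebra B} {hZ : IsTerminal Z} (hZ' : IsTerminal Z')
    {α : F.obj Z.V ⟶ Z.V} (h : DefinableByDistributiveLaw hZ α) (e : Z ≅ Z') :
    DefinableByDistributiveLaw hZ' (F.map e.inv.f ≫ α ≫ e.hom.f) := by
  obtain ⟨G, lam, κ, rfl⟩ := h
  refine ⟨G, lam, κ, ?_⟩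
  rw [← map_inducedMap_comp hZ hZ' lam e.inv e.hom, Category.assoc, κ.naturality_assoc]

/-- The map `G A_ω ⟶ B_ω` induced by a distributive law. -/
noncomputable def omegaInduced {A B G : Type u ⥤ Type u} (hA : OmegaContinuous A)
    (hB : OmegaContinuous B) (lam : A ⋙ G ⟶ G ⋙ B) : G.obj (omega A) ⟶ omega B :=
  inducedMap (omegaCoalgebra hA) (omegaCoalgebraIsTerminal hB) lam

theorem omegaInduced_str {A B G : Type u ⥤ Type u} (hA : OmegaContinuous A)
    (hB : OmegaContinuous B) (lam : A ⋙ G ⟶ G ⋙ B) :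
    omegaInduced hA hB lam ≫ omegaStr hB =
      G.map (omegaStr hA) ≫ lam.app (omega A) ≫ B.map (omegaInduced hA hB lam) :=
  inducedMap_str (omegaCoalgebra hA) (omegaCoalgebraIsTerminal hB) lam

/-- The recursion that determines the projections of an induced map, used in inductions on `n`. -/
theorem omegaInduced_proj_succ {A B G : Type u ⥤ Type u} (hA : OmegaContinuous A)
    (hB : OmegaContinuous B) (lam : A ⋙ G ⟶ G ⋙ B) (n : ℕ) :
    omegaInduced hA hB lam ≫ omegaProj B (n + 1) =
      G.map (omegaStr hA) ≫ lam.app (omega A) ≫ B.map (omegaInduced hA hB lam ≫ omegaProj B n) := by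
  refine (congrArg (omegaInduced hA hB lam ≫ ·) (omegaStr_proj hB n)).symm.trans ?_
  have h := congrArg (· ≫ B.map (omegaProj B n)) (omegaInduced_str hA hB lam)
  simp only [Category.assoc, ← B.map_comp] at h
  exact h

theorem exists_omegaInduced_proj {A B G : Type u ⥤ Type u} (hA : OmegaContinuous A)
    (hB : OmegaContinuous B) (lam : A ⋙ G ⟶ G ⋙ B) (n : ℕ) :
    ∃ b : G.obj (stage A n) ⟶ stage B n,
      omegaInduced hA hB lam ≫ omegaProj B n =
        G.map (omegaProj A n) ≫ b := by
  induction n with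
  | zero => exact ⟨↾fun _ => PUnit.unit, stage_zero_hom_ext B _ _⟩
  | succ n ih =>
    obtain ⟨b, hb⟩ := ih
    refine ⟨lam.app (stage A n) ≫ B.map b, ?_⟩
    have hnat : G.map (A.map (omegaProj A n)) ≫ lam.app (stage A n) =
      lam.app (omega A) ≫ B.map (G.map (omegaProj A n)) := lam.naturality (omegaProj A n)
    have h := omegaInduced_proj_succ hA hB lam n
    rw [hb, B.map_comp, ← reassoc_of% hnat, ← G.map_comp_assoc] at h
    exact h.trans (congrArg (fun t => G.map t ≫ lam.app (stage A n) ≫ B.map b)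
      (omegaStr_proj hA n))

theorem isCausal_comp_omegaInduced {A B F G : Type u ⥤ Type u} (hA : OmegaContinuous A)
    (hB : OmegaContinuous B) (lam : A ⋙ G ⟶ G ⋙ B) (κ : F ⟶ G) :
    IsCausal A B F (κ.app (omega A) ≫
      omegaInduced hA hB lam) := by
  intro X f g i h
  obtain ⟨b, hb⟩ := exists_omegaInduced_proj hA hB lam i
  have key (f : X ⟶ omega A) : F.map f ≫ (κ.app (omega A) ≫
      omegaInduced hA hB lam) ≫ omegaProj B i =
      κ.app X ≫ G.map (f ≫ omegaProj A i) ≫ b := by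
    rw [Category.assoc, κ.naturality_assoc, hb, G.map_comp_assoc]
  exact (key f).trans ((congrArg (fun t => κ.app X ≫ G.map t ≫ b) h).trans (key g).symm)

/-! ### The codensity functor of the final sequences -/

/-- The pointwise right Kan extension of the final sequence of `B` along that of `A`, both
restricted to finite ordinals: an element over `X` is a compatible family of functions
`(X ⟶ A_n) → B_n`. -/
def codensity (A B : Type u ⥤ Type u) : Type u ⥤ Type u where
  obj X := { τ : ∀ n, (X ⟶ stage A n) → stage B n //
    ∀ n f, stageMap B n (τ (n + 1) f) = τ n (f ≫ stageMap A n) }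
  map g := ↾fun τ => ⟨fun n f => τ.1 n (g ≫ f), fun n f => τ.2 n (g ≫ f)⟩

/-- Evaluation of the elements of the codensity functor at a map `X ⟶ A_n`; these are the
projections of the limit defining it. -/
def codensityEval {A : Type u ⥤ Type u} (B : Type u ⥤ Type u) {X : Type u} {n : ℕ}
    (f : X ⟶ stage A n) : (codensity A B).obj X ⟶ stage B n :=
  ↾fun τ => τ.1 n f

theorem codensity_map_eval {A B : Type u ⥤ Type u} {X Y : Type u} (g : X ⟶ Y) {n : ℕ}
    (f : Y ⟶ stage A n) :
    (codensity A B).map g ≫ codensityEval B f = codensityEval B (g ≫ f) :=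
  rfl

theorem codensityEval_stageMap {A B : Type u ⥤ Type u} {X : Type u} {n : ℕ}
    (f : X ⟶ stage A (n + 1)) :
    codensityEval B f ≫ stageMap B n = codensityEval B (f ≫ stageMap A n) := by
  ext τ
  exact τ.2 n f

/-- A functor `X ↦ ∐_{a} X^{P_a}` preserves the limit defining `codensity A B`. The diagram is
connected, because there is only one map `X ⟶ A_0`; hence all members of a compatible family lie
over the same `a`. -/
theorem polyFunctor_codensity_existsUnique (P : PFunctor.{u, u}) {A B : Type u ⥤ Type u}
    {X : Type u} (t : ∀ n, (X ⟶ stage A n) → (polyFunctor P).obj (stage B n))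
    (ht : ∀ n f, (polyFunctor P).map (stageMap B n) (t (n + 1) f) = t n (f ≫ stageMap A n)) :
    ∃! z : (polyFunctor P).obj ((codensity A B).obj X),
      ∀ n f, (polyFunctor P).map (codensityEval B f) z = t n f := by
  let f₀ : X ⟶ stage A 0 := ↾fun _ => PUnit.unit
  have hfst : ∀ n f, (t n f).1 = (t 0 f₀).1 := by
    intro n
    induction n with
    | zero => exact fun f => by rw [stage_zero_hom_ext A f f₀]
    | succ n ih => exact fun f => (congrArg Sigma.fst (ht n f)).trans (ih _)
  have hg : ∀ n f, ∃ g : P.B (t 0 f₀).1 → stage B n, t n f = ⟨(t 0 f₀).1, g⟩ := by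
    intro n f
    have h := hfst n f
    revert h
    generalize t n f = s
    generalize (t 0 f₀).1 = a
    rintro rfl
    exact ⟨s.2, rfl⟩
  choose g hg using hg
  have hcomp : ∀ b n f, stageMap B n (g (n + 1) f b) = g n (f ≫ stageMap A n) b := by
    intro b n f
    have h := ht n f
    rw [hg (n + 1), hg n] at h
    exact congrFun (eq_of_heq (Sigma.mk.inj h).2) b
  refine ⟨⟨_, fun b => ⟨fun n f => g n f b, hcomp b⟩⟩, fun n f => (hg n f).symm, ?_⟩
  rintro ⟨a, y⟩ hy
  obtain rfl : a = (t 0 f₀).1 := congrArg Sigma.fst (hy 0 f₀)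
  refine Sigma.ext rfl (heq_of_eq (funext fun b => Subtype.ext (funext fun n => funext fun f => ?_)))
  have h := hy n f
  rw [hg n] at h
  exact congrFun (eq_of_heq (Sigma.mk.inj h).2) b

theorem IsPolynomial.codensity_existsUnique {A B : Type u ⥤ Type u} (hB : IsPolynomial B)
    {X : Type u} (t : ∀ n, (X ⟶ stage A n) → B.obj (stage B n))
    (ht : ∀ n f, B.map (stageMap B n) (t (n + 1) f) = t n (f ≫ stageMap A n)) :
    ∃! z : B.obj ((codensity A B).obj X), ∀ n f, B.map (codensityEval B f) z = t n f := by
  obtain ⟨P, ⟨e⟩⟩ := hB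
  have hinj {Y : Type u} {x y : B.obj Y} (h : e.hom.app Y x = e.hom.app Y y) : x = y := by
    simpa using congrArg (e.inv.app Y) h
  obtain ⟨z, hz, huniq⟩ := polyFunctor_codensity_existsUnique P (A := A) (B := B) (X := X)
    (fun n f => e.hom.app _ (t n f)) (fun n f => by
      rw [← ht, NatTrans.naturality_apply])
  refine ⟨e.inv.app _ z, fun n f => hinj ?_, fun y hy => hinj ?_⟩
  · rw [NatTrans.naturality_apply]
    simpa using hz n f
  · rw [huniq (e.hom.app _ y) fun n f => ?_]
    · simp
    · rw [← hy n f, NatTrans.naturality_apply]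

theorem IsPolynomial.codensity_hom_ext {A B : Type u ⥤ Type u} (hB : IsPolynomial B)
    {X Y : Type u} {p q : Y ⟶ B.obj ((codensity A B).obj X)}
    (h : ∀ n (f : X ⟶ stage A n),
      p ≫ B.map (codensityEval B f) = q ≫ B.map (codensityEval B f)) : p = q := by
  ext y
  refine (hB.codensity_existsUnique (fun n f => B.map (codensityEval B f) (q y)) ?_).unique
    (fun n f => ConcreteCategory.congr_hom (h n f) y) fun n f => rfl
  intro n f
  rw [← codensityEval_stageMap, B.map_comp]
  rfl

/-- The distributive law on the codensity functor. It sends `τ` over `A X` to the element of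
`B (codensity A B X)` whose image under evaluation at `f : X ⟶ A_n` is `τ_{n+1} (A f)`. -/
theorem IsPolynomial.exists_codensityLaw {A B : Type u ⥤ Type u} (hB : IsPolynomial B) :
    ∃ lam : A ⋙ codensity A B ⟶ codensity A B ⋙ B, ∀ (X : Type u) (n : ℕ) (f : X ⟶ stage A n),
      lam.app X ≫ B.map (codensityEval B f) =
        codensityEval (A := A) B (n := n + 1) (A.map f) := by
  have hex (X : Type u) : ∃ l : (codensity A B).obj (A.obj X) ⟶ B.obj ((codensity A B).obj X),
      ∀ (n : ℕ) (f : X ⟶ stage A n), l ≫ B.map (codensityEval B f) =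
        codensityEval (A := A) B (n := n + 1) (A.map f) := by
    have h (τ : (codensity A B).obj (A.obj X)) :=
      (hB.codensity_existsUnique (fun n (f : X ⟶ stage A n) => τ.1 (n + 1) (A.map f))
        (fun n f => by rw [A.map_comp]; exact τ.2 (n + 1) (A.map f))).exists
    choose l hl using h
    exact ⟨↾l, fun n f => by ext τ; exact hl τ n f⟩
  choose l hl using hex
  refine ⟨{ app := l, naturality := fun X Y g => hB.codensity_hom_ext fun n f => ?_ }, hl⟩
  change ((codensity A B).map (A.map g) ≫ l Y) ≫ B.map (codensityEval B f) =
    (l X ≫ B.map ((codensity A B).map g)) ≫ B.map (codensityEval B f)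
  rw [Category.assoc, Category.assoc, hl, ← B.map_comp, codensity_map_eval, hl, A.map_comp]
  rfl

theorem omegaInduced_codensity_proj {A B : Type u ⥤ Type u} (hA : OmegaContinuous A)
    (hB : OmegaContinuous B) (lam : A ⋙ codensity A B ⟶ codensity A B ⋙ B)
    (hlam : ∀ (X : Type u) (n : ℕ) (f : X ⟶ stage A n),
      lam.app X ≫ B.map (codensityEval B f) =
        codensityEval (A := A) B (n := n + 1) (A.map f)) (n : ℕ) :
    omegaInduced hA hB lam ≫ omegaProj B n =
      codensityEval B (omegaProj A n) := by
  induction n with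
  | zero => exact stage_zero_hom_ext B _ _
  | succ n ih =>
    rw [omegaInduced_proj_succ, ih, hlam]
    exact congrArg (codensityEval (A := A) B (n := n + 1)) (omegaStr_proj hA n)

/-! ### Causal maps as natural transformations into the codensity functor -/

theorem nonempty_omega {A : Type u ⥤ Type u} (x : stage A 1) : Nonempty (omega A) :=
  ⟨omegaUnfold (Endofunctor.Coalgebra.mk (stage A 0) (↾fun _ => x)) PUnit.unit⟩

/-- The projections of `A_ω` need not be surjective, but they have partial sections
`s n : A_{n+1} ⟶ A_ω` that are compatible with the connecting maps. There is no such section on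
`A_0` when `A_ω` is empty. -/
theorem exists_omegaSection (A : Type u ⥤ Type u) :
    ∃ s : ∀ n, stage A (n + 1) ⟶ omega A,
      (∀ n, omegaProj A (n + 1) ≫ s n ≫ omegaProj A (n + 1) = omegaProj A (n + 1)) ∧
      ∀ n, s (n + 1) ≫ omegaProj A (n + 1) =
        stageMap A (n + 1) ≫ s n ≫ omegaProj A (n + 1) := by
  classical
  -- A point outside the image of the projection is sent where its truncation is sent.
  let s : ∀ n, stage A (n + 1) → omega A := fun n => Nat.rec
    (fun x => if h : ∃ z, omegaProj A 1 z = x then h.choose else (nonempty_omega x).some)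
    (fun n s x => if h : ∃ z, omegaProj A (n + 2) z = x then h.choose
      else s (stageMap A (n + 1) x)) n
  have hs (n : ℕ) (z : omega A) :
      omegaProj A (n + 1) (s n (omegaProj A (n + 1) z)) = omegaProj A (n + 1) z := by
    have h : ∃ z', omegaProj A (n + 1) z' = omegaProj A (n + 1) z := ⟨z, rfl⟩
    have hsz : s n (omegaProj A (n + 1) z) = h.choose := by
      cases n <;> exact dif_pos h
    rw [hsz]
    exact h.choose_spec
  have hproj (n : ℕ) (z : omega A) : stageMap A n (omegaProj A (n + 1) z) = omegaProj A n z :=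
    ConcreteCategory.congr_hom (omegaProj_succ A n) z
  refine ⟨fun n => ↾s n, fun n => by ext z; exact hs n z, fun n => ?_⟩
  ext x
  change omegaProj A (n + 1) (s (n + 1) x) = omegaProj A (n + 1) (s n (stageMap A (n + 1) x))
  by_cases h : ∃ z, omegaProj A (n + 2) z = x
  · obtain ⟨z, rfl⟩ := h
    rw [← hproj (n + 1), hs (n + 1), hproj (n + 1), hs n]
  · have hsx : s (n + 1) x = s n (stageMap A (n + 1) x) := dif_neg h
    rw [hsx]

/-- A causal map is the limit of compatible maps between the stages. -/
theorem IsCausal.exists_stageMaps {A B F : Type u ⥤ Type u} {α : F.obj (omega A) ⟶ omega B}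
    (hα : IsCausal A B F α) :
    ∃ a : ∀ n, F.obj (stage A n) ⟶ stage B n,
      (∀ n, a (n + 1) ≫ stageMap B n = F.map (stageMap A n) ≫ a n) ∧
      ∀ n, F.map (omegaProj A n) ≫ a n = α ≫ omegaProj B n := by
  obtain ⟨s, hs, hs'⟩ := exists_omegaSection A
  let a : ∀ n, F.obj (stage A n) ⟶ stage B n
    | 0 => ↾fun _ => PUnit.unit
    | n + 1 => F.map (s n) ≫ α ≫ omegaProj B (n + 1)
  refine ⟨a, fun n => ?_, fun n => ?_⟩
  · cases n with
    | zero => exact stage_zero_hom_ext B _ _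
    | succ n =>
      change (F.map (s (n + 1)) ≫ α ≫ omegaProj B (n + 2)) ≫ stageMap B (n + 1) =
        F.map (stageMap A (n + 1)) ≫ F.map (s n) ≫ α ≫ omegaProj B (n + 1)
      rw [Category.assoc, Category.assoc, omegaProj_succ, ← F.map_comp_assoc]
      exact hα _ _ _ _ ((hs' n).trans (Category.assoc _ _ _).symm)
  · cases n with
    | zero => exact stage_zero_hom_ext B _ _
    | succ n =>
      change F.map (omegaProj A (n + 1)) ≫ F.map (s n) ≫ α ≫ omegaProj B (n + 1) = _
      rw [← F.map_comp_assoc, hα _ (omegaProj A (n + 1) ≫ s n) (𝟙 _) (n + 1)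
        (by rw [Category.assoc, hs, Category.id_comp]), F.map_id, Category.id_comp]

theorem IsCausal.exists_law {A B F : Type u ⥤ Type u} (hA : OmegaContinuous A)
    (hB : IsPolynomial B) {α : F.obj (omega A) ⟶ omega B} (hα : IsCausal A B F α) :
    ∃ (G : Type u ⥤ Type u) (lam : A ⋙ G ⟶ G ⋙ B) (κ : F ⟶ G),
      κ.app (omega A) ≫ omegaInduced hA hB.omegaContinuous lam = α := by
  obtain ⟨lam, hlam⟩ := hB.exists_codensityLaw (A := A)
  obtain ⟨a, ha, ha'⟩ := hα.exists_stageMaps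
  let κ : F ⟶ codensity A B :=
    { app := fun X => ↾fun x => ⟨fun n f => a n (F.map f x), fun n f => by
        change stageMap B n (a (n + 1) (F.map f x)) = a n (F.map (f ≫ stageMap A n) x)
        rw [F.map_comp]
        exact ConcreteCategory.congr_hom (ha n) (F.map f x)⟩
      naturality := fun X Y g => by
        ext x
        refine Subtype.ext (funext fun n => funext fun f => ?_)
        change a n (F.map f (F.map g x)) = a n (F.map (g ≫ f) x)
        rw [F.map_comp]
        rfl }
  refine ⟨codensity A B, lam, κ, omega_hom_ext B fun n => ?_⟩
  refine (Category.assoc _ _ _).trans ?_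
  refine (congrArg (fun t => κ.app (omega A) ≫ t)
    (omegaInduced_codensity_proj hA hB.omegaContinuous lam hlam n)).trans ?_
  exact ha' n

theorem isCausal_iff_exists_law {A B F : Type u ⥤ Type u} (hA : OmegaContinuous A)
    (hB : IsPolynomial B) (α : F.obj (omega A) ⟶ omega B) :
    IsCausal A B F α ↔
      ∃ (G : Type u ⥤ Type u) (lam : A ⋙ G ⟶ G ⋙ B) (κ : F ⟶ G),
        κ.app (omega A) ≫ omegaInduced hA hB.omegaContinuous lam = α := by
  refine ⟨IsCausal.exists_law hA hB, ?_⟩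
  rintro ⟨G, lam, κ, rfl⟩
  exact isCausal_comp_omegaInduced hA hB.omegaContinuous lam κ

/-! ### Streams -/

theorem streamFunctor_isPolynomial (K : Type u) : IsPolynomial (streamFunctor K) :=
  ⟨⟨K, fun _ => PUnit⟩, ⟨
    { hom := { app := fun X => ↾fun p => ⟨p.1, fun _ => p.2⟩ }
      inv := { app := fun X => ↾fun p => (p.1, p.2 PUnit.unit) } }⟩⟩

/-- Two streams agree in the `n`-th stage of the final sequence iff their first `n` values do. -/
theorem approx_stream_eq_iff {K : Type u} (n : ℕ) (σ τ : ℕ → K) :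
    approx (streamCoalgebra K) n σ = approx (streamCoalgebra K) n τ ↔ ∀ k < n, σ k = τ k := by
  induction n generalizing σ τ with
  | zero => exact ⟨fun _ _ h => absurd h (Nat.not_lt_zero _), fun _ => rfl⟩
  | succ n ih =>
    have h : approx (streamCoalgebra K) (n + 1) σ = approx (streamCoalgebra K) (n + 1) τ ↔
        σ 0 = τ 0 ∧ approx (streamCoalgebra K) n (fun k => σ (k + 1)) =
          approx (streamCoalgebra K) n (fun k => τ (k + 1)) := Prod.mk_inj
    rw [h, ih, Nat.forall_lt_succ_left]

/-- The stream coalgebra is isomorphic to the coalgebra on the limit of the final sequence. -/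
noncomputable def streamIso (K : Type u) :
    streamCoalgebra K ≅ omegaCoalgebra (streamFunctor_isPolynomial K).omegaContinuous :=
  (streamCoalgebraIsTerminal K).uniqueUpToIso (omegaCoalgebraIsTerminal _)

/-- The map underlying the isomorphism from the stream coalgebra. -/
noncomputable def streamToOmega (K : Type u) : (ℕ → K) ⟶ omega (streamFunctor K) :=
  (streamIso K).hom.f

/-- The map underlying the isomorphism onto the stream coalgebra. -/
noncomputable def omegaToStream (K : Type u) : omega (streamFunctor K) ⟶ (ℕ → K) :=
  (streamIso K).inv.f

theorem streamToOmega_proj_eq_iff {K : Type u} (n : ℕ) (σ τ : ℕ → K) :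
    omegaProj (streamFunctor K) n (streamToOmega K σ) =
      omegaProj (streamFunctor K) n (streamToOmega K τ) ↔ ∀ k < n, σ k = τ k := by
  have h : streamToOmega K ≫ omegaProj (streamFunctor K) n = approx (streamCoalgebra K) n :=
    omegaLift_proj _ _ (approx_succ (streamCoalgebra K)) n
  rw [← approx_stream_eq_iff, ← h]
  rfl

theorem streamToOmega_omegaToStream {K : Type u} (x : omega (streamFunctor K)) :
    streamToOmega K (omegaToStream K x) = x :=
  ConcreteCategory.congr_hom (congrArg Endofunctor.Coalgebra.Hom.f (streamIso K).inv_hom_id) x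

theorem omegaToStream_streamToOmega {K : Type u} (σ : ℕ → K) :
    omegaToStream K (streamToOmega K σ) = σ :=
  ConcreteCategory.congr_hom (congrArg Endofunctor.Coalgebra.Hom.f (streamIso K).hom_inv_id) σ

theorem isCausalStreamFunction_iff {K V : Type u} (φ : (V → ℕ → K) → ℕ → K) :
    IsCausalStreamFunction φ ↔
      IsCausal (streamFunctor K) (streamFunctor K) (powerFunctor V)
        ((powerFunctor V).map (omegaToStream K) ≫ streamAlgebra φ ≫ streamToOmega K) := by
  constructor
  · intro h X f g i hfg
    ext x
    refine (streamToOmega_proj_eq_iff i _ _).2 (h i _ _ fun v => ?_)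
    refine (streamToOmega_proj_eq_iff i _ _).1 ?_
    change omegaProj (streamFunctor K) i (streamToOmega K (omegaToStream K (f (x v)))) =
      omegaProj (streamFunctor K) i (streamToOmega K (omegaToStream K (g (x v))))
    rw [streamToOmega_omegaToStream, streamToOmega_omegaToStream]
    exact ConcreteCategory.congr_hom hfg (x v)
  · intro h i σ τ hστ
    -- Causality is applied to the tuples `σ` and `τ` as maps out of `V`, at the identity tuple.
    have key := ConcreteCategory.congr_hom (h V (↾fun v => streamToOmega K (σ v))
      (↾fun v => streamToOmega K (τ v)) i (by
        ext v
        exact (streamToOmega_proj_eq_iff i _ _).2 (hστ v))) (id : V → V)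
    have hinv (ρ : V → ℕ → K) :
        (fun v => omegaToStream K (streamToOmega K (ρ v))) = ρ :=
      funext fun v => omegaToStream_streamToOmega (ρ v)
    have key' := (streamToOmega_proj_eq_iff i _ _).1 key
    change ∀ k < i, φ (fun v => omegaToStream K (streamToOmega K (σ v))) k =
      φ (fun v => omegaToStream K (streamToOmega K (τ v))) k at key'
    rwa [hinv, hinv] at key'

theorem definable_streamAlgebra_iff {K V : Type u} (φ : (V → ℕ → K) → ℕ → K) :
    DefinableByDistributiveLaw (streamCoalgebraIsTerminal K) (streamAlgebra φ) ↔
      DefinableByDistributiveLaw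
        (omegaCoalgebraIsTerminal (streamFunctor_isPolynomial K).omegaContinuous)
        ((powerFunctor V).map (omegaToStream K) ≫ streamAlgebra φ ≫ streamToOmega K) := by
  refine ⟨fun h => h.of_iso _ (streamIso K), fun h => ?_⟩
  have h' := h.of_iso (streamCoalgebraIsTerminal K) (streamIso K).symm
  refine cast (congrArg (DefinableByDistributiveLaw _) ?_) h'
  ext σ
  change omegaToStream K (streamToOmega K (φ fun v => omegaToStream K (streamToOmega K (σ v)))) =
    φ σ
  refine (omegaToStream_streamToOmega _).trans ?_
  exact congrArg φ (funext fun v => omegaToStream_streamToOmega (σ v))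

end CausalDL

theorem mainTheorem6 :
    (∀ (A B F : Type u ⥤ Type u) (hA : CausalDL.OmegaContinuous A) (hB : CausalDL.IsPolynomial B)
      (α : F.obj (CausalDL.omega A) ⟶ CausalDL.omega B),
      CausalDL.IsCausal A B F α ↔
        ∃ (G : Type u ⥤ Type u) (lam : A ⋙ G ⟶ G ⋙ B) (κ : F ⟶ G),
          κ.app (CausalDL.omega A) ≫
            CausalDL.inducedMap (CausalDL.omegaCoalgebra hA)
              (CausalDL.omegaCoalgebraIsTerminal hB.omegaContinuous) lam = α) ∧
    (∀ (B F : Type u ⥤ Type u) (hB : CausalDL.IsPolynomial B)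
      (α : F.obj (CausalDL.omega B) ⟶ CausalDL.omega B),
      CausalDL.IsCausal B B F α ↔
        CausalDL.DefinableByDistributiveLaw
          (CausalDL.omegaCoalgebraIsTerminal hB.omegaContinuous) α) ∧
    (∀ (K V : Type u) (φ : (V → ℕ → K) → ℕ → K),
      CausalDL.IsCausalStreamFunction φ ↔
        CausalDL.DefinableByDistributiveLaw (CausalDL.streamCoalgebraIsTerminal K)
          (CausalDL.streamAlgebra φ)) := by
  refine ⟨fun A B F hA hB α => CausalDL.isCausal_iff_exists_law hA hB α,
    fun B F hB α => CausalDL.isCausal_iff_exists_law hB.omegaContinuous hB α, fun K V φ => ?_⟩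
  rw [CausalDL.isCausalStreamFunction_iff, CausalDL.definable_streamAlgebra_iff]
  exact CausalDL.isCausal_iff_exists_law _ (CausalDL.streamFunctor_isPolynomial K) _
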